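/- A Dyck path of semilength $n$ is a lattice path from $(0,0)$ to $(n,n)$ consisting of $n$ north steps $N=(0,1)$ and $n$ east steps $E=(1,0)$ that never goes below the line $y=x$. A parking function of size $n$ is a Dyck path of semilength $n$ whose north steps are labeled with the distinct integers $1,\dots,n$ so that the labels of any two immediately consecutive north steps increase along the path. Reading the labels of the north steps of a parking function $p$ in order along the path gives a permutation $\phi(p)$ of $\{1,\dots,n\}$. For permutations $\rho_1,\dots,\rho_m$, let $\mathrm{pf}_n(\rho_1,\dots,\rho_m)$ be the number of parking functions $p$ of size $n$ such that $\phi(p)$ avoids each of the patterns $\rho_1,\dots,\rho_m$ (i.e. has no subsequence order-isomorphic to any $\rho_j$). Then for every $n\ge 1$, $$\mathrm{pf}_n(213,312)=\sum_{k=0}^{n-1}\sum_{i=0}^{k}\binom{n-1}{i}\cdot\frac{(k+1)\binom{2n-2-k}{n-1-k}}{n}.$$ Moreover, call a north step of a Dyck path single if it is neither immediately preceded nor immediately followed by a north step. For $0\le k\le n-1$, let $d(n,k)$ be the number of Dyck paths of semilength $n$ for which $k$ is the largest integer with $k\le n-1$ such that the final $k$ north steps of the path are all single (so the initial north step of the path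 is never counted, and $(NE)^n$ has $k=n-1$). Then $$d(n,k)=\frac{(k+1)\binom{2n-2-k}{n-1-k}}{n}.$$ -/

import Mathlib

/-- A permutation `π` of length `n` contains the pattern `ρ` of length `m` if there are positions
`f 0 < f 1 < ⋯ < f (m - 1)` at which the entries of `π` are order-isomorphic to `ρ`. Permutations
of length `n` are permutations of `Fin n = {0, …, n - 1}` (positions and values shifted by one). -/
def ContainsPattern {n m : ℕ} (π : Equiv.Perm (Fin n)) (ρ : Equiv.Perm (Fin m)) : Prop :=
  ∃ f : Fin m → Fin n, StrictMono f ∧ ∀ a b : Fin m, π (f a) ≤ π (f b) ↔ ρ a ≤ ρ b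

/-- A permutation avoids a pattern if it does not contain it. -/
def AvoidsPattern {n m : ℕ} (π : Equiv.Perm (Fin n)) (ρ : Equiv.Perm (Fin m)) : Prop :=
  ¬ ContainsPattern π ρ

/-- The pattern 213, in values shifted by one: `0 ↦ 1`, `1 ↦ 0`, `2 ↦ 2`. -/
def pattern213 : Equiv.Perm (Fin 3) where
  toFun := ![1, 0, 2]
  invFun := ![1, 0, 2]
  left_inv := by decide
  right_inv := by decide

/-- The pattern 312, in values shifted by one: `0 ↦ 2`, `1 ↦ 0`, `2 ↦ 1`. -/
def pattern312 : Equiv.Perm (Fin 3) where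
  toFun := ![2, 0, 1]
  invFun := ![1, 2, 0]
  left_inv := by decide
  right_inv := by decide

/-- A parking function of size `n` as a labeled Dyck path: a Dyck path of semilength `n` (Mathlib's
`DyckWord`; `DyckStep.U` is a north step and `DyckStep.D` an east step) together with a labeling of
its north steps, in their order along the path, by the permutation `label`, such that the labels of
two north steps that follow each other immediately in the path increase. -/
structure LabeledDyckPath (n : ℕ) where
  /-- the underlying Dyck path -/
  path : DyckWord
  /-- the path goes from `(0, 0)` to `(n, n)` -/
  semilength_path : path.semilength = n
  /-- `label a` is the label of the `a`-th north step (counted from zero); thus `label` is also the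
  permutation obtained by reading the labels of the north steps in order -/
  label : Equiv.Perm (Fin n)
  /-- if the steps in places `j` and `j + 1` of the path are both north, and they are the north steps
  number `a` and `b`, then the label of the first is less than the label of the second -/
  label_lt : ∀ (j : ℕ) (a b : Fin n),
    path.toList[j]? = some DyckStep.U → path.toList[j + 1]? = some DyckStep.U →
    (path.toList.take j).count DyckStep.U = (a : ℕ) →
    (path.toList.take (j + 1)).count DyckStep.U = (b : ℕ) →
    label a < label b

/-- `pf n P` is the number of parking functions of size `n` whose permutation avoids all the
patterns (of length `m`) in `P`. -/
noncomputable def pf {m : ℕ} (n : ℕ) (P : Set (Equiv.Perm (Fin m))) : ℕ :=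
  Nat.card {p : LabeledDyckPath n // ∀ ρ ∈ P, AvoidsPattern p.label ρ}

/-- The step in place `j` of the Dyck path is a single north step: it is a north step, and neither
the step right after it nor the step right before it (if there is one) is a north step. -/
def IsSingleNorthStep (p : DyckWord) (j : ℕ) : Prop :=
  p.toList[j]? = some DyckStep.U ∧ p.toList[j + 1]? ≠ some DyckStep.U ∧
    ∀ i : ℕ, i + 1 = j → p.toList[i]? ≠ some DyckStep.U

/-- The final `k` north steps of the Dyck path (those preceded by at least `p.semilength - k`
north steps) are all single north steps. -/
def FinalNorthStepsSingle (p : DyckWord) (k : ℕ) : Prop :=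
  ∀ j : ℕ, p.toList[j]? = some DyckStep.U →
    p.semilength ≤ (p.toList.take j).count DyckStep.U + k → IsSingleNorthStep p j

/-- The number of Dyck paths of semilength `n` that end in exactly `k` single north steps: `k` is
the greatest number such that the final `k` north steps are single. The initial north step of a
path is never counted (hence `l < n`); this only matters for the path `(NE)^n`, all of whose north
steps are single, and which is counted for `k = n - 1`. -/
noncomputable def numDyckFinalSingles (n k : ℕ) : ℕ :=
  Nat.card {p : DyckWord // p.semilength = n ∧
    IsGreatest {l : ℕ | l < n ∧ FinalNorthStepsSingle p l} k}

/-
Avoiding 213 and 312 means having no valley, so `φ(p)` increases up to its largest entry and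
decreases from there on. Such a permutation is determined by the set of entries before the largest
one; if these are `i` in number, there are `(n - 1).choose i` possibilities. Labels must increase
along consecutive north steps, so a path admits the permutation exactly when its final `n - 1 - i`
north steps are single.

In a Dyck path whose final `l` north steps are single, each of the last `l + 1` north steps is
followed by an east step. Reading the path from its end, the usual recursion for ballot numbers
shows that there are `(2n - 1 - l).choose n - (2n - 1 - l).choose (n + 1)` such paths when `l < n`.
Differences in `l` give `d(n, k)`; conversely the number of paths for `l` is the sum of `d(n, k)`
over `k ≥ l`, and exchanging the two sums gives the formula for `pf`.
-/

section Patterns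

theorem containsPattern_iff_strictMono {n m : ℕ} {π : Equiv.Perm (Fin n)}
    {ρ : Equiv.Perm (Fin m)} :
    ContainsPattern π ρ ↔ ∃ f : Fin m → Fin n, StrictMono f ∧ StrictMono (π ∘ f ∘ ρ.symm) := by
  refine exists_congr fun f => and_congr_right fun _ => ⟨fun h => ?_, fun h a b => ?_⟩
  · exact strictMono_of_le_iff_le fun a b => by simpa using (h (ρ.symm a) (ρ.symm b)).symm
  · simpa using h.le_iff_le (a := ρ a) (b := ρ b)

theorem strictMono_fin_three_iff {α : Type*} [Preorder α] {f : Fin 3 → α} :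
    StrictMono f ↔ f 0 < f 1 ∧ f 1 < f 2 := by
  rw [Fin.strictMono_iff_lt_succ, Fin.forall_fin_two]
  rfl

theorem containsPattern_fin_three_iff {n : ℕ} {π : Equiv.Perm (Fin n)}
    {ρ : Equiv.Perm (Fin 3)} :
    ContainsPattern π ρ ↔ ∃ a b c : Fin n, (a < b ∧ b < c) ∧
      StrictMono (π ∘ ![a, b, c] ∘ ρ.symm) := by
  rw [containsPattern_iff_strictMono, ← FinVec.exists_iff]
  exact exists₃_congr fun a b c => and_congr_left' strictMono_fin_three_iff

/-- A valley of `f` is an entry with larger entries on both sides, not necessarily adjacent. -/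
def HasValley {α β : Type*} [LT α] [LT β] (f : α → β) : Prop :=
  ∃ a b c, (a < b ∧ b < c) ∧ f b < f a ∧ f b < f c

theorem containsPattern_213_or_312_iff_hasValley {n : ℕ} {π : Equiv.Perm (Fin n)} :
    ContainsPattern π pattern213 ∨ ContainsPattern π pattern312 ↔ HasValley π := by
  simp only [containsPattern_fin_three_iff, strictMono_fin_three_iff, ← exists_or, ← and_or_left]
  refine exists₃_congr fun a b c => and_congr_right fun ⟨hab, hbc⟩ => ?_
  have hac : π a ≠ π c := π.injective.ne (hab.trans hbc).ne
  change (π b < π a ∧ π a < π c) ∨ (π b < π c ∧ π c < π a) ↔ _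
  grind

end Patterns

section Unimodal

/-- `f` increases up to its peak at position `j` and decreases from there on. -/
def IsUnimodalAt {α β : Type*} [Preorder α] [Preorder β] (f : α → β) (j : α) : Prop :=
  StrictMonoOn f (Set.Iic j) ∧ StrictAntiOn f (Set.Ici j)

variable {α β : Type*} [LinearOrder α] [LinearOrder β] {f : α → β} {j : α}

theorem IsUnimodalAt.apply_le (hf : IsUnimodalAt f j) (i : α) : f i ≤ f j := by
  rcases le_total i j with hij | hji
  · exact hf.1.monotoneOn hij Set.self_mem_Iic hij
  · exact hf.2.antitoneOn Set.self_mem_Ici hji hji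

theorem IsUnimodalAt.not_hasValley (hf : IsUnimodalAt f j) : ¬ HasValley f := by
  rintro ⟨a, b, c, ⟨hab, hbc⟩, hba, hbc'⟩
  rcases le_total b j with hb | hb
  · exact hba.not_gt (hf.1 (hab.le.trans hb) hb hab)
  · exact hbc'.not_gt (hf.2 hb (hb.trans hbc.le) hbc)

theorem isUnimodalAt_of_not_hasValley (hinj : f.Injective) (hmax : ∀ i, f i ≤ f j)
    (hf : ¬ HasValley f) : IsUnimodalAt f j := by
  have hlt {i : α} (hi : i ≠ j) : f i < f j := (hmax i).lt_of_ne (hinj.ne hi)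
  constructor
  · intro a _ b (hb : b ≤ j) hab
    rcases hb.eq_or_lt with rfl | hbj
    · exact hlt hab.ne
    · by_contra! hba
      exact hf ⟨a, b, j, ⟨hab, hbj⟩, hba.lt_of_ne (hinj.ne hab.ne'), hlt hbj.ne⟩
  · intro a (ha : j ≤ a) b _ hab
    rcases ha.eq_or_lt with rfl | hja
    · exact hlt hab.ne'
    · by_contra! hba
      exact hf ⟨j, a, b, ⟨hja, hab⟩, hlt hja.ne', hba.lt_of_ne (hinj.ne hab.ne)⟩

theorem IsUnimodalAt.apply_lt_apply_iff (hf : IsUnimodalAt f j) {a b : α} (hab : a ⋖ b) :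
    f a < f b ↔ a < j := by
  refine ⟨fun h => ?_, fun haj => hf.1 haj.le (hab.ge_of_gt haj) hab.lt⟩
  by_contra! hja
  exact h.not_gt (hf.2 hja (hja.trans hab.le) hab.lt)

end Unimodal

section CountUnimodal

theorem nonempty_orderIso_of_card_eq {α β : Type*} [LinearOrder α] [LinearOrder β] [Fintype α]
    [Fintype β] (h : Fintype.card α = Fintype.card β) : Nonempty (α ≃o β) :=
  ⟨(monoEquivOfFin α h).symm.trans (monoEquivOfFin β rfl)⟩

theorem eqOn_of_strictMonoOn_of_image_eq {α β : Type*} [LinearOrder α] [WellFoundedLT α]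
    [PartialOrder β] {f g : α → β} {s : Set α} (hf : StrictMonoOn f s) (hg : StrictMonoOn g s)
    (h : f '' s = g '' s) : Set.EqOn f g s := by
  rw [← strictMono_domRestrict] at hf hg
  rw [← Set.range_domRestrict, ← Set.range_domRestrict] at h
  exact Set.domRestrict_eq_domRestrict_iff.1 ((hf.range_inj hg).1 h)

variable {α : Type*} [LinearOrder α] [LocallyFiniteOrderBot α] {j : α} {s : Finset α}

theorem exists_perm_strictMonoOn_strictAntiOn [Finite α] (hs : s.card = (Finset.Iio j).card) :
    ∃ σ : Equiv.Perm α, StrictMonoOn σ (Set.Iio j) ∧ StrictAntiOn σ (Set.Ici j) ∧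
      (Finset.Iio j).map σ.toEmbedding = s := by
  cases nonempty_fintype α
  obtain ⟨f⟩ : Nonempty ({i // i < j} ≃o {x // x ∈ s}) := by
    refine nonempty_orderIso_of_card_eq ?_
    rw [Fintype.card_coe, hs, Fintype.card_of_subtype _ fun _ => Finset.mem_Iio]
  obtain ⟨g⟩ : Nonempty ({i // ¬ i < j} ≃o {x // x ∉ s}ᵒᵈ) := by
    refine nonempty_orderIso_of_card_eq ?_
    rw [Fintype.card_orderDual, Fintype.card_subtype_compl, Fintype.card_subtype_compl,
      Fintype.card_coe, hs, Fintype.card_of_subtype _ fun _ => Finset.mem_Iio]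
  let σ : Equiv.Perm α := Equiv.subtypeCongr f.toEquiv (g.toEquiv.trans OrderDual.ofDual)
  have σ_of_lt {i : α} (hi : i < j) : σ i = f ⟨i, hi⟩ := by
    simp [σ, Equiv.subtypeCongr, Equiv.sumCompl_symm_apply_of_pos (p := (· < j)) hi]
  have σ_of_not_lt {i : α} (hi : ¬ i < j) : σ i = (g ⟨i, hi⟩).ofDual := by
    simp [σ, Equiv.subtypeCongr, Equiv.sumCompl_symm_apply_of_neg (p := (· < j)) hi]
  refine ⟨σ, fun a ha b hb hab => ?_, fun a ha b hb hab => ?_, ?_⟩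
  · rw [σ_of_lt ha, σ_of_lt hb]
    exact f.strictMono hab
  · rw [σ_of_not_lt (not_lt.2 ha), σ_of_not_lt (not_lt.2 hb)]
    exact g.strictMono hab
  · refine Finset.eq_of_subset_of_card_le (fun x hx => ?_) (by simp [hs])
    obtain ⟨i, hi, rfl⟩ := Finset.mem_map.1 hx
    exact (σ_of_lt (Finset.mem_Iio.1 hi)).symm ▸ (f _).2

theorem IsUnimodalAt.map_Iio_mem [Fintype α] [OrderTop α] {σ : Equiv.Perm α}
    (hσ : IsUnimodalAt σ j) :
    (Finset.Iio j).map σ.toEmbedding ∈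
      (Finset.univ.erase ⊤).powersetCard (Finset.Iio j).card := by
  refine Finset.mem_powersetCard.2 ⟨fun x hx => ?_, Finset.card_map _⟩
  obtain ⟨i, hi, rfl⟩ := Finset.mem_map.1 hx
  have hij := Finset.mem_Iio.1 hi
  exact Finset.mem_erase.2
    ⟨(hσ.1 hij.le Set.self_mem_Iic hij).ne_top, Finset.mem_univ _⟩

theorem IsUnimodalAt.eq_of_map_Iio_eq [Finite α] {σ τ : Equiv.Perm α}
    (hσ : IsUnimodalAt σ j) (hτ : IsUnimodalAt τ j)
    (h : (Finset.Iio j).map σ.toEmbedding = (Finset.Iio j).map τ.toEmbedding) : σ = τ := by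
  have h_Iio : σ '' Set.Iio j = τ '' Set.Iio j := by
    simpa using congrArg (fun s : Finset α => (s : Set α)) h
  have h_Ici : σ '' Set.Ici j = τ '' Set.Ici j := by
    rw [← Set.compl_Iio, Set.image_compl_eq σ.bijective, Set.image_compl_eq τ.bijective, h_Iio]
  ext i
  rcases lt_or_ge i j with hi | hi
  · exact eqOn_of_strictMonoOn_of_image_eq (hσ.1.mono Set.Iio_subset_Iic_self)
      (hτ.1.mono Set.Iio_subset_Iic_self) h_Iio hi
  · exact eqOn_of_strictMonoOn_of_image_eq (β := αᵒᵈ) hσ.2 hτ.2 h_Ici hi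

theorem exists_isUnimodalAt_map_Iio_eq [Fintype α] [OrderTop α]
    (hs : s ∈ (Finset.univ.erase ⊤).powersetCard (Finset.Iio j).card) :
    ∃ σ : Equiv.Perm α, IsUnimodalAt σ j ∧ (Finset.Iio j).map σ.toEmbedding = s := by
  obtain ⟨hs_top, hs_card⟩ := Finset.mem_powersetCard.1 hs
  obtain ⟨σ, hmono, hanti, rfl⟩ := exists_perm_strictMonoOn_strictAntiOn hs_card
  have hpeak : j ≤ σ.symm ⊤ := by
    by_contra! hlt
    exact (Finset.mem_erase.1 (hs_top (Finset.mem_map_of_mem _ (Finset.mem_Iio.2 hlt)))).1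
      (σ.apply_symm_apply ⊤)
  have hσj : σ j = ⊤ := by
    rw [eq_top_iff, ← σ.apply_symm_apply ⊤]
    exact hanti.antitoneOn Set.self_mem_Ici hpeak hpeak
  refine ⟨σ, ⟨?_, hanti⟩, rfl⟩
  rw [← Set.Iio_insert, strictMonoOn_insert_iff_of_forall_le (s := Set.Iio j) fun _ h => le_of_lt h]
  refine ⟨fun i hi _ => ?_, hmono⟩
  rw [hσj, lt_top_iff_ne_top, ← hσj]
  exact σ.injective.ne (ne_of_lt hi)

theorem card_isUnimodalAt [Fintype α] [OrderTop α] (j : α) :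
    Nat.card {σ : Equiv.Perm α // IsUnimodalAt σ j} =
      (Fintype.card α - 1).choose (Finset.Iio j).card := by
  have hbij : Set.BijOn (fun σ : Equiv.Perm α => (Finset.Iio j).map σ.toEmbedding)
      {σ | IsUnimodalAt σ j} ↑((Finset.univ.erase (⊤ : α)).powersetCard (Finset.Iio j).card) := by
    refine ⟨fun _ hσ => hσ.map_Iio_mem, fun _ hσ _ hτ h => hσ.eq_of_map_Iio_eq hτ h, ?_⟩
    exact fun s hs => exists_isUnimodalAt_map_Iio_eq (Finset.mem_coe.1 hs)
  calc Nat.card {σ : Equiv.Perm α // IsUnimodalAt σ j}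
      = ((Finset.univ.erase (⊤ : α)).powersetCard (Finset.Iio j).card).card :=
        hbij.ncard_eq.trans (Set.ncard_coe_finset _)
    _ = (Fintype.card α - 1).choose (Finset.Iio j).card := by
        rw [Finset.card_powersetCard, Finset.card_erase_of_mem (Finset.mem_univ _),
          Finset.card_univ]

end CountUnimodal

section DyckTails

open DyckStep

/-- `L` behaves like the end of a Dyck word whose final `l` north steps are single. Both conditions
are put on suffixes, so that such lists can be built by adding steps on the left. -/
def IsDyckTail (l : ℕ) (L : List DyckStep) : Prop :=
  (∀ t, t <:+ L → t.count U ≤ t.count D) ∧ ∀ t, U :: U :: t <:+ L → l ≤ t.count U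

/-- The Dyck tails with `u` north and `d` east steps; the Dyck words among them have `u = d`. -/
def dyckTails (l u d : ℕ) : Set (List DyckStep) :=
  {L | IsDyckTail l L ∧ L.count U = u ∧ L.count D = d}

variable {l u d : ℕ} {L t : List DyckStep}

theorem IsDyckTail.count_U_le_count_D (h : IsDyckTail l L) : L.count U ≤ L.count D :=
  h.1 L List.suffix_rfl

theorem isDyckTail_D_cons : IsDyckTail l (D :: t) ↔ IsDyckTail l t := by
  simp only [IsDyckTail, List.suffix_cons_iff, or_imp, forall_and, forall_eq]
  grind

theorem isDyckTail_U_cons : IsDyckTail l (U :: t) ↔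
    IsDyckTail l t ∧ t.count U < t.count D ∧ ∀ t', t = U :: t' → l ≤ t'.count U := by
  simp only [IsDyckTail, List.suffix_cons_iff, or_imp, forall_and, forall_eq]
  grind

theorem nil_mem_dyckTails : [] ∈ dyckTails l 0 0 := by
  simp [dyckTails, IsDyckTail]

theorem D_cons_mem_dyckTails : D :: t ∈ dyckTails l u (d + 1) ↔ t ∈ dyckTails l u d := by
  simp [dyckTails, isDyckTail_D_cons]

theorem U_cons_mem_dyckTails (hud : u < d) (hlu : l < u) :
    U :: t ∈ dyckTails l (u + 1) d ↔ t ∈ dyckTails l u d := by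
  simp only [dyckTails, Set.mem_ofPred_eq, isDyckTail_U_cons]
  grind

theorem U_cons_D_cons_mem_dyckTails (hud : u ≤ d) :
    U :: D :: t ∈ dyckTails l (u + 1) (d + 1) ↔ t ∈ dyckTails l u d := by
  simp only [dyckTails, Set.mem_ofPred_eq, isDyckTail_U_cons, isDyckTail_D_cons]
  grind

theorem U_cons_U_cons_notMem_dyckTails (hul : u ≤ l) :
    U :: U :: t ∉ dyckTails l (u + 1) d := by
  simp only [dyckTails, Set.mem_ofPred_eq, isDyckTail_U_cons]
  grind

instance : Finite DyckStep :=
  Finite.of_injective (fun s : DyckStep => decide (s = U)) fun a b => by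
    cases a <;> cases b <;> simp

theorem length_eq_count_U_add_count_D (L : List DyckStep) :
    L.length = L.count U + L.count D := by
  induction L with
  | nil => rfl
  | cons s t ih => cases s <;> grind

theorem finite_dyckTails : (dyckTails l u d).Finite := by
  refine (List.finite_length_eq DyckStep (u + d)).subset ?_
  rintro L ⟨-, rfl, rfl⟩
  exact length_eq_count_U_add_count_D L

theorem dyckTails_eq_empty (h : d < u) : dyckTails l u d = ∅ := by
  rw [Set.eq_empty_iff_forall_notMem]
  rintro L ⟨hL, rfl, rfl⟩
  exact hL.count_U_le_count_D.not_gt h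

theorem dyckTails_zero_zero : dyckTails l 0 0 = {[]} := by
  refine Set.eq_singleton_iff_unique_mem.2 ⟨nil_mem_dyckTails, ?_⟩
  rintro L ⟨-, hu, hd⟩
  rw [← List.length_eq_zero_iff, length_eq_count_U_add_count_D, hu, hd]

theorem dyckTails_zero_succ : dyckTails l 0 (d + 1) = List.cons D '' dyckTails l 0 d := by
  ext (_ | ⟨_ | _, t⟩)
  · simp [dyckTails]
  · simp [dyckTails]
  · simp [D_cons_mem_dyckTails]

theorem dyckTails_succ_succ_of_lt (hud : u ≤ d) (hlu : l < u) :
    dyckTails l (u + 1) (d + 1) =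
      List.cons U '' dyckTails l u (d + 1) ∪ List.cons D '' dyckTails l (u + 1) d := by
  ext (_ | ⟨_ | _, t⟩)
  · simp [dyckTails]
  · simp [U_cons_mem_dyckTails (Nat.lt_succ_of_le hud) hlu]
  · simp [D_cons_mem_dyckTails]

theorem dyckTails_succ_succ_of_le (hud : u ≤ d) (hul : u ≤ l) :
    dyckTails l (u + 1) (d + 1) =
      List.cons U '' (List.cons D '' dyckTails l u d) ∪ List.cons D '' dyckTails l (u + 1) d := by
  ext (_ | ⟨_ | _, _ | ⟨_ | _, t⟩⟩)
  · simp [dyckTails]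
  · simp [dyckTails]
  · simp [U_cons_U_cons_notMem_dyckTails hul]
  · simp [U_cons_D_cons_mem_dyckTails hud]
  all_goals simp [D_cons_mem_dyckTails]

theorem ncard_image_cons_union_image_cons {α : Type*} {a b : α} (hab : a ≠ b)
    {S T : Set (List α)} (hS : S.Finite) (hT : T.Finite) :
    (List.cons a '' S ∪ List.cons b '' T).ncard = S.ncard + T.ncard := by
  rw [Set.ncard_union_eq _ (hS.image _) (hT.image _),
    Set.ncard_image_of_injective _ List.cons_injective,
    Set.ncard_image_of_injective _ List.cons_injective]
  rw [Set.disjoint_left]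
  rintro _ ⟨s, -, rfl⟩ ⟨t, -, h⟩
  exact hab (List.cons.inj h).1.symm

theorem ncard_dyckTails_succ_succ_of_lt (hud : u ≤ d) (hlu : l < u) :
    (dyckTails l (u + 1) (d + 1)).ncard =
      (dyckTails l u (d + 1)).ncard + (dyckTails l (u + 1) d).ncard := by
  rw [dyckTails_succ_succ_of_lt hud hlu,
    ncard_image_cons_union_image_cons (by decide) finite_dyckTails finite_dyckTails]

theorem ncard_dyckTails_succ_succ_of_le (hud : u ≤ d) (hul : u ≤ l) :
    (dyckTails l (u + 1) (d + 1)).ncard =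
      (dyckTails l u d).ncard + (dyckTails l (u + 1) d).ncard := by
  rw [dyckTails_succ_succ_of_le hud hul, ncard_image_cons_union_image_cons (by decide)
    (finite_dyckTails.image _) finite_dyckTails,
    Set.ncard_image_of_injective _ List.cons_injective]

theorem ncard_dyckTails_zero : (dyckTails l 0 d).ncard = 1 := by
  induction d with
  | zero => rw [dyckTails_zero_zero, Set.ncard_singleton]
  | succ d ih => rw [dyckTails_zero_succ, Set.ncard_image_of_injective _ List.cons_injective, ih]

-- The formula comes from deleting the `D` that has to follow each of the last `l + 1` letters `U`:
-- this leaves ballot sequences. The subtraction is truncated on purpose, with value 0 if all `u`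
-- letters `U` are of this kind.
theorem ncard_dyckTails_add_choose (hud : u ≤ d + 1) :
    (dyckTails l u d).ncard + (u - (l + 1) + d).choose (d + 1) =
      (u - (l + 1) + d).choose u := by
  induction u generalizing d with
  | zero => simp [ncard_dyckTails_zero]
  | succ u ihu =>
    induction d with
    | zero => simp [dyckTails_eq_empty, Nat.le_zero.1 (Nat.succ_le_succ_iff.1 hud)]
    | succ d ihd =>
      obtain hu | hu : u = d + 1 ∨ u ≤ d := by omega
      · simp [dyckTails_eq_empty, hu]
      have hd := ihd (Nat.succ_le_succ hu)
      rcases lt_or_ge l u with hlu | hul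
      · have hu' := ihu (d := d + 1) (by omega)
        rw [show u + 1 - (l + 1) + d = u - (l + 1) + (d + 1) by omega] at hd
        rw [ncard_dyckTails_succ_succ_of_lt hu hlu,
          show u + 1 - (l + 1) + (d + 1) = u - (l + 1) + (d + 1) + 1 by omega,
          Nat.choose_succ_succ', Nat.choose_succ_succ']
        omega
      · have hu' := ihu (d := d) (by omega)
        rw [Nat.sub_eq_zero_of_le (Nat.le_succ_of_le hul), zero_add, Nat.choose_succ_self] at hu'
        rw [Nat.sub_eq_zero_of_le (Nat.succ_le_succ hul), zero_add] at hd ⊢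
        rw [Nat.choose_succ_self] at hd ⊢
        rw [ncard_dyckTails_succ_succ_of_le hu hul, Nat.choose_succ_succ']
        omega

end DyckTails

section DoubleRises

open DyckStep

/-- The `a`-th `U` of `L`, counted from zero, is immediately followed by another `U`. -/
def IsDoubleRise (L : List DyckStep) (a : ℕ) : Prop :=
  ∃ r t, L = r ++ U :: U :: t ∧ r.count U = a

theorem count_take_succ_of_getElem? {L : List DyckStep} {j : ℕ} (h : L[j]? = some U) :
    (L.take (j + 1)).count U = (L.take j).count U + 1 := by
  simp [List.take_add_one, h]

theorem isDoubleRise_iff_exists_getElem? {L : List DyckStep} {a : ℕ} :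
    IsDoubleRise L a ↔ ∃ j, L[j]? = some U ∧ L[j + 1]? = some U ∧ (L.take j).count U = a := by
  constructor
  · rintro ⟨r, t, rfl, rfl⟩
    exact ⟨r.length, by simp, by simp, by simp⟩
  · rintro ⟨j, hj, hj', rfl⟩
    obtain ⟨hlt, hU⟩ := List.getElem?_eq_some_iff.1 hj
    obtain ⟨hlt', hU'⟩ := List.getElem?_eq_some_iff.1 hj'
    refine ⟨L.take j, L.drop (j + 2), ?_, rfl⟩
    conv_lhs => rw [← List.take_append_drop j L, List.drop_eq_getElem_cons hlt,
      List.drop_eq_getElem_cons hlt', hU, hU']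

theorem IsDoubleRise.add_two_le_count {L : List DyckStep} {a : ℕ} (h : IsDoubleRise L a) :
    a + 2 ≤ L.count U := by
  obtain ⟨r, t, rfl, rfl⟩ := h
  simp only [List.count_append, List.count_cons_self]
  omega

theorem forall_isDoubleRise_iff_forall_suffix {L : List DyckStep} {l : ℕ} :
    (∀ a, IsDoubleRise L a → a + 1 + l < L.count U) ↔
      ∀ t, U :: U :: t <:+ L → l ≤ t.count U := by
  have hcount (r t : List DyckStep) :
      r.count U + 1 + l < (r ++ U :: U :: t).count U ↔ l ≤ t.count U := by
    simp only [List.count_append, List.count_cons_self]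
    omega
  constructor
  · rintro h t ⟨r, rfl⟩
    exact (hcount r t).1 (h _ ⟨r, t, rfl, rfl⟩)
  · rintro h _ ⟨r, t, rfl, rfl⟩
    exact (hcount r t).2 (h t ⟨r, rfl⟩)

theorem finalNorthStepsSingle_iff_forall_isDoubleRise {p : DyckWord} {l : ℕ} :
    FinalNorthStepsSingle p l ↔ ∀ a, IsDoubleRise p.toList a → a + 1 + l < p.semilength := by
  constructor
  · intro h a ha
    obtain ⟨j, hj, hj', rfl⟩ := isDoubleRise_iff_exists_getElem?.1 ha
    by_contra! hle
    rw [← count_take_succ_of_getElem? hj] at hle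
    exact (h (j + 1) hj' hle).2.2 j rfl hj
  · intro h j hj hle
    have hrise {i : ℕ} (hi : p.toList[i]? = some U) (hi' : p.toList[i + 1]? = some U) :
        (p.toList.take i).count U + 1 + l < p.semilength :=
      h _ (isDoubleRise_iff_exists_getElem?.2 ⟨i, hi, hi', rfl⟩)
    refine ⟨hj, fun hj' => ?_, ?_⟩
    · have := hrise hj hj'
      omega
    · rintro i rfl hi
      have := hrise hi hj
      rw [count_take_succ_of_getElem? hi] at hle
      omega

theorem FinalNorthStepsSingle.mono {p : DyckWord} {k l : ℕ} (hkl : k ≤ l)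
    (h : FinalNorthStepsSingle p l) : FinalNorthStepsSingle p k :=
  fun j hj hk => h j hj (hk.trans (Nat.add_le_add_left hkl _))

theorem forall_count_take_le_iff_forall_suffix {L : List DyckStep}
    (hL : L.count U = L.count D) :
    (∀ i, (L.take i).count D ≤ (L.take i).count U) ↔
      ∀ t, t <:+ L → t.count U ≤ t.count D := by
  have hsplit {r t : List DyckStep} (h : r ++ t = L) :
      r.count D ≤ r.count U ↔ t.count U ≤ t.count D := by
    rw [← h, List.count_append, List.count_append] at hL
    omega
  constructor
  · rintro h t ⟨r, rfl⟩
    exact (hsplit rfl).1 (by simpa using h r.length)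
  · intro h i
    exact (hsplit (List.take_append_drop i L)).2 (h _ (List.drop_suffix i L))

theorem finalNorthStepsSingle_iff_isDyckTail {p : DyckWord} {l : ℕ} :
    FinalNorthStepsSingle p l ↔ IsDyckTail l p.toList := by
  rw [finalNorthStepsSingle_iff_forall_isDoubleRise, DyckWord.semilength,
    forall_isDoubleRise_iff_forall_suffix, IsDyckTail, and_iff_right]
  exact (forall_count_take_le_iff_forall_suffix p.count_U_eq_count_D).1 p.count_D_le_count_U

theorem image_toList_finalNorthStepsSingle (n l : ℕ) :
    DyckWord.toList '' {p | p.semilength = n ∧ FinalNorthStepsSingle p l} = dyckTails l n n := by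
  ext L
  constructor
  · rintro ⟨p, ⟨hn, hp⟩, rfl⟩
    exact ⟨finalNorthStepsSingle_iff_isDyckTail.1 hp, hn, p.count_U_eq_count_D ▸ hn⟩
  · rintro ⟨hL, hU, hD⟩
    have hUD : L.count U = L.count D := hU.trans hD.symm
    exact ⟨⟨L, hUD, (forall_count_take_le_iff_forall_suffix hUD).2 hL.1⟩,
      ⟨hU, finalNorthStepsSingle_iff_isDyckTail.2 hL⟩, rfl⟩

end DoubleRises

section FinalSingles

/-- The Dyck words of semilength `n` that end in at least `l` single north steps, the initial
north step never being counted (hence `l < n`). -/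
def dyckFinalSingles (n l : ℕ) : Set DyckWord :=
  {p | p.semilength = n ∧ l < n ∧ FinalNorthStepsSingle p l}

variable {n k l : ℕ}

theorem finite_dyckFinalSingles : (dyckFinalSingles n l).Finite :=
  have : Finite {p : DyckWord | p.semilength = n} :=
    inferInstanceAs (Finite {p : DyckWord // p.semilength = n})
  (Set.toFinite {p : DyckWord | p.semilength = n}).subset fun _ hp => hp.1

theorem dyckFinalSingles_antitone : Antitone (dyckFinalSingles n) :=
  fun _ _ hkl _ hp => ⟨hp.1, hkl.trans_lt hp.2.1, hp.2.2.mono hkl⟩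

theorem dyckFinalSingles_self : dyckFinalSingles n n = ∅ := by
  simp [dyckFinalSingles]

theorem ncard_dyckFinalSingles_add_choose (hn : n ≠ 0) (hl : l ≤ n) :
    (dyckFinalSingles n l).ncard + (2 * n - 1 - l).choose (n + 1) = (2 * n - 1 - l).choose n := by
  rcases hl.lt_or_eq with hl | rfl
  · have hset : dyckFinalSingles n l = {p | p.semilength = n ∧ FinalNorthStepsSingle p l} := by
      simp only [dyckFinalSingles, hl, true_and]
    have hinj : Function.Injective DyckWord.toList := fun _ _ => DyckWord.ext
    rw [hset, ← Set.ncard_image_of_injective _ hinj, image_toList_finalNorthStepsSingle,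
      show 2 * n - 1 - l = n - (l + 1) + n by omega]
    exact ncard_dyckTails_add_choose (Nat.le_succ n)
  · rw [dyckFinalSingles_self, Set.ncard_empty, Nat.choose_eq_zero_of_lt (by omega),
      Nat.choose_eq_zero_of_lt (by omega)]

theorem isGreatest_iff_of_isLowerSet {α : Type*} [LinearOrder α] [SuccOrder α] [NoMaxOrder α]
    {s : Set α} (hs : IsLowerSet s) {a : α} : IsGreatest s a ↔ a ∈ s ∧ Order.succ a ∉ s := by
  refine and_congr_right fun _ => ⟨fun h hsucc => ?_, fun h b hb => ?_⟩
  · exact (h hsucc).not_gt (Order.lt_succ a)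
  · by_contra! hab
    exact h (hs (Order.succ_le_of_lt hab) hb)

theorem numDyckFinalSingles_add_ncard (n k : ℕ) :
    numDyckFinalSingles n k + (dyckFinalSingles n (k + 1)).ncard =
      (dyckFinalSingles n k).ncard := by
  have hlower (p : DyckWord) : IsLowerSet {l | l < n ∧ FinalNorthStepsSingle p l} :=
    fun _ _ hkl hl => ⟨hkl.trans_lt hl.1, hl.2.mono hkl⟩
  have hdiff : {p : DyckWord | p.semilength = n ∧
      IsGreatest {l | l < n ∧ FinalNorthStepsSingle p l} k} =
        dyckFinalSingles n k \ dyckFinalSingles n (k + 1) := by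
    ext p
    simp only [isGreatest_iff_of_isLowerSet (hlower p), dyckFinalSingles, Set.mem_sdiff,
      Set.mem_ofPred_eq, Order.succ_eq_add_one]
    tauto
  rw [← Set.ncard_sdiff_add_ncard_of_subset (dyckFinalSingles_antitone (Nat.le_succ k))
    finite_dyckFinalSingles, ← hdiff]
  rfl

theorem ncard_dyckFinalSingles_eq_sum (hl : l ≤ n) :
    (dyckFinalSingles n l).ncard = ∑ k ∈ Finset.Ico l n, numDyckFinalSingles n k := by
  induction hl using Nat.decreasingInduction with
  | self => simp [dyckFinalSingles_self]
  | of_succ k hk ih => rw [← numDyckFinalSingles_add_ncard, ih, Finset.sum_eq_sum_Ico_succ_bot hk]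

theorem numDyckFinalSingles_add_choose (hk : k < n) :
    numDyckFinalSingles n k + (2 * n - 2 - k).choose n = (2 * n - 2 - k).choose (n - 1) := by
  obtain ⟨m, rfl⟩ := Nat.exists_eq_add_one_of_ne_zero (Nat.ne_zero_of_lt hk)
  have hadd := numDyckFinalSingles_add_ncard (m + 1) k
  have hcard := ncard_dyckFinalSingles_add_choose (n := m + 1) m.succ_ne_zero hk.le
  have hcard' := ncard_dyckFinalSingles_add_choose (n := m + 1) (l := k + 1) m.succ_ne_zero hk
  rw [show 2 * (m + 1) - 1 - k = 2 * (m + 1) - 2 - k + 1 by omega, Nat.choose_succ_succ',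
    Nat.choose_succ_succ'] at hcard
  rw [show 2 * (m + 1) - 1 - (k + 1) = 2 * (m + 1) - 2 - k by omega] at hcard'
  rw [Nat.add_sub_cancel]
  omega

theorem numDyckFinalSingles_mul (hk : k < n) :
    numDyckFinalSingles n k * n = (k + 1) * (2 * n - 2 - k).choose (n - 1 - k) := by
  obtain ⟨r, rfl⟩ := Nat.exists_eq_add_of_lt hk
  have hadd := numDyckFinalSingles_add_choose hk
  have hmul := Nat.choose_succ_right_eq (k + r + r) (k + r)
  have hsymm : (k + r + r).choose (k + r) = (k + r + r).choose r := Nat.choose_symm_add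
  rw [show 2 * (k + r + 1) - 2 - k = k + r + r by omega, Nat.add_sub_cancel] at hadd
  rw [Nat.add_sub_cancel_left] at hmul
  rw [show 2 * (k + r + 1) - 2 - k = k + r + r by omega,
    show k + r + 1 - 1 - k = r by omega, ← hsymm]
  zify at hadd hmul ⊢
  linear_combination (k + r + 1 : ℤ) * hadd - hmul

theorem cast_numDyckFinalSingles (hk : k < n) :
    (numDyckFinalSingles n k : ℚ) =
      ((k : ℚ) + 1) * ((2 * n - 2 - k).choose (n - 1 - k) : ℚ) / (n : ℚ) := by
  rw [eq_div_iff (Nat.cast_ne_zero.2 (Nat.ne_zero_of_lt hk))]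
  exact_mod_cast numDyckFinalSingles_mul hk

end FinalSingles

section ParkingFunctions

open DyckStep

variable {n : ℕ}

theorem label_lt_iff_finalNorthStepsSingle {p : DyckWord} (hp : p.semilength = n)
    {σ : Equiv.Perm (Fin n)} {i : Fin n} (hσ : IsUnimodalAt σ i) :
    (∀ (j : ℕ) (a b : Fin n), p.toList[j]? = some U → p.toList[j + 1]? = some U →
      (p.toList.take j).count U = a → (p.toList.take (j + 1)).count U = b → σ a < σ b) ↔
      FinalNorthStepsSingle p (n - 1 - i) := by
  have hlt {a b : Fin n} (hab : (b : ℕ) = a + 1) :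
      σ a < σ b ↔ (a : ℕ) + 1 + (n - 1 - i) < n := by
    rw [hσ.apply_lt_apply_iff (Fin.covBy_iff.2 (Nat.covBy_iff_add_one_eq.2 hab.symm)),
      Fin.lt_def]
    omega
  rw [finalNorthStepsSingle_iff_forall_isDoubleRise, hp]
  constructor
  · intro h a ha
    have ha_lt : a + 2 ≤ n := hp ▸ ha.add_two_le_count
    obtain ⟨j, hj, hj', rfl⟩ := isDoubleRise_iff_exists_getElem?.1 ha
    exact (hlt rfl).1 (h j ⟨(p.toList.take j).count U, by omega⟩
      ⟨(p.toList.take j).count U + 1, ha_lt⟩ hj hj' rfl (count_take_succ_of_getElem? hj))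
  · intro h j a b hj hj' ha hb
    rw [count_take_succ_of_getElem? hj, ha] at hb
    exact (hlt hb.symm).2 (h a (isDoubleRise_iff_exists_getElem?.2 ⟨j, hj, hj', ha⟩))

theorem avoidsPattern_213_312_iff_isUnimodalAt [NeZero n] {σ : Equiv.Perm (Fin n)} :
    (∀ ρ ∈ ({pattern213, pattern312} : Set (Equiv.Perm (Fin 3))), AvoidsPattern σ ρ) ↔
      IsUnimodalAt σ (σ.symm ⊤) := by
  simp only [Set.mem_insert_iff, Set.mem_singleton_iff, forall_eq_or_imp, forall_eq,
    AvoidsPattern, ← not_or, containsPattern_213_or_312_iff_hasValley]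
  exact ⟨isUnimodalAt_of_not_hasValley σ.injective (by simp), IsUnimodalAt.not_hasValley⟩

theorem IsUnimodalAt.symm_top_eq [NeZero n] {σ : Equiv.Perm (Fin n)} {i : Fin n}
    (hσ : IsUnimodalAt σ i) : σ.symm ⊤ = i := by
  rw [Equiv.symm_apply_eq, eq_comm, eq_top_iff, ← σ.apply_symm_apply ⊤]
  exact hσ.apply_le _

/-- A parking function avoiding 213 and 312 amounts to the position `i` of its largest label, a
permutation with its peak there, and a Dyck path whose double rises all come early enough for the
labels to decrease after position `i`. -/
def unimodalParkingEquiv (n : ℕ) [NeZero n] :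
    {p : LabeledDyckPath n // ∀ ρ ∈ ({pattern213, pattern312} : Set (Equiv.Perm (Fin 3))),
      AvoidsPattern p.label ρ} ≃
    Σ i : Fin n, {σ : Equiv.Perm (Fin n) // IsUnimodalAt σ i} × dyckFinalSingles n (n - 1 - i) where
  toFun p :=
    have h := avoidsPattern_213_312_iff_isUnimodalAt.1 p.2
    ⟨p.1.label.symm ⊤, ⟨p.1.label, h⟩, ⟨p.1.path, p.1.semilength_path, by omega,
      (label_lt_iff_finalNorthStepsSingle p.1.semilength_path h).1 p.1.label_lt⟩⟩
  invFun := fun ⟨_, ⟨σ, hσ⟩, ⟨p, hp⟩⟩ =>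
    ⟨⟨p, hp.1, σ, (label_lt_iff_finalNorthStepsSingle hp.1 hσ).2 hp.2.2⟩,
      avoidsPattern_213_312_iff_isUnimodalAt.2 (hσ.symm_top_eq.symm ▸ hσ)⟩
  left_inv _ := rfl
  right_inv := by
    rintro ⟨i, ⟨σ, hσ⟩, ⟨p, hp⟩⟩
    obtain rfl := hσ.symm_top_eq
    rfl

theorem pf_eq_sum_choose_mul_ncard (n : ℕ) [NeZero n] :
    pf n {pattern213, pattern312} =
      ∑ i ∈ Finset.range n, (n - 1).choose i * (dyckFinalSingles n i).ncard := by
  have (i : ℕ) : Finite (dyckFinalSingles n i) := finite_dyckFinalSingles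
  rw [pf, Nat.card_congr (unimodalParkingEquiv n), Nat.card_sigma, ← Finset.sum_range_reflect,
    Finset.sum_range]
  refine Finset.sum_congr rfl fun i _ => ?_
  rw [Nat.card_prod, card_isUnimodalAt, Fin.card_Iio, Fintype.card_fin,
    Nat.choose_symm (by omega), Nat.card_coe_set_eq]

theorem pf_eq_sum_choose_mul_numDyckFinalSingles (n : ℕ) [NeZero n] :
    pf n {pattern213, pattern312} = ∑ k ∈ Finset.range n, ∑ i ∈ Finset.range (k + 1),
      (n - 1).choose i * numDyckFinalSingles n k := by
  calc pf n {pattern213, pattern312}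
      = ∑ i ∈ Finset.range n, ∑ k ∈ Finset.Ico i n,
          (n - 1).choose i * numDyckFinalSingles n k := by
        rw [pf_eq_sum_choose_mul_ncard]
        refine Finset.sum_congr rfl fun i hi => ?_
        rw [ncard_dyckFinalSingles_eq_sum (Finset.mem_range.1 hi).le, Finset.mul_sum]
    _ = ∑ k ∈ Finset.range n, ∑ i ∈ Finset.range (k + 1),
          (n - 1).choose i * numDyckFinalSingles n k := by
        refine Finset.sum_comm' fun i k => ?_
        simp only [Finset.mem_range, Finset.mem_Ico]
        omega

end ParkingFunctions

theorem theoremT (n : ℕ) (hn : 1 ≤ n) :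
    ((pf n {pattern213, pattern312} : ℕ) : ℚ) =
        ∑ k ∈ Finset.range n, ∑ i ∈ Finset.range (k + 1),
          ((n - 1).choose i : ℚ) *
            (((k : ℚ) + 1) * ((2 * n - 2 - k).choose (n - 1 - k) : ℚ) / (n : ℚ)) ∧
      ∀ k : ℕ, k < n →
        ((numDyckFinalSingles n k : ℕ) : ℚ) =
          ((k : ℚ) + 1) * ((2 * n - 2 - k).choose (n - 1 - k) : ℚ) / (n : ℚ) := by
  refine ⟨?_, fun k hk => cast_numDyckFinalSingles hk⟩
  have : NeZero n := ⟨Nat.one_le_iff_ne_zero.1 hn⟩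
  rw [pf_eq_sum_choose_mul_numDyckFinalSingles]
  push_cast
  refine Finset.sum_congr rfl fun k hk => Finset.sum_congr rfl fun i _ => ?_
  rw [cast_numDyckFinalSingles (Finset.mem_range.1 hk)]
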